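/- Theorem 7.9. Let $A$ be a commutative integral quantale, that is, a complete lattice (least element $0$, greatest element $1$) with a commutative associative multiplication that distributes over arbitrary joins and has $1$ as unit. Assume that $A$ is coherent: every element of $A$ is a join of compact elements, $1$ is compact, and the product of two compact elements is compact. Assume also that $A$ is normal: whenever $a\vee b=1$ there are $e,f\in A$ with $a\vee e=b\vee f=1$ and $ef=0$. Let $\mathrm{Spec}(A)$ be the set of $m$-prime elements of $A$ (those $p<1$ such that $ab\le p$ implies $a\le p$ or $b\le p$), and $\mathrm{Max}(A)\subseteq\mathrm{Spec}(A)$ the set of maximal elements (those maximal among the elements $<1$). The Zariski topology on $\mathrm{Spec}(A)$ has as closed sets the sets $\{p\in\mathrm{Spec}(A): a\le p\}$, $a\in A$; the flat topology on $\mathrm{Spec}(A)$ has as a basis of open sets the complements of the Zariski-compact Zariski-open subsets. Write $\mathrm{Spec}_F(A)$ for $\mathrm{Spec}(A)$ with the flat topology and $\mathrm{Max}_F(A)$ for $\mathrm{Max}(A)$ with the induced subspace topology. Let $\gamma:\mathrm{Spec}(A)\to\mathrm{Max}(A)$ be the retraction that sends each $p$ to the unique maximal element $m$ with $p\le m$ (it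 exists because $A$ is normal and coherent). Then $\gamma:\mathrm{Spec}_F(A)\to\mathrm{Max}_F(A)$ is continuous if and only if $\mathrm{Max}_F(A)$ is compact. -/

import Mathlib

/-!
Quantales are Mathlib's `IsQuantale`. A commutative integral quantale is a commutative monoid that
is a quantale and whose unit `1` is the top element. Compact elements are `IsCompactElement`, and
"algebraic" (every element is a join of compact elements) is `IsCompactlyGenerated`.
-/

namespace CoherentQuantale

/-- A coherent (commutative, integral) quantale: the unit is the top element, every element is a
join of compact elements, the unit is compact, and compact elements are closed under products. -/
class IsCoherentQuantale (A : Type*) [CommMonoid A] [CompleteLattice A] [IsQuantale A] : Prop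
    extends IsCompactlyGenerated A where
  one_eq_top : (1 : A) = ⊤
  isCompactElement_one : IsCompactElement (1 : A)
  isCompactElement_mul : ∀ c d : A, IsCompactElement c → IsCompactElement d →
    IsCompactElement (c * d)

/-- A quantale is normal if `a ⊔ b = 1` implies `a ⊔ e = b ⊔ f = 1` for some `e, f`
with `e * f = 0` (the least element). -/
class IsNormalQuantale (A : Type*) [CommMonoid A] [CompleteLattice A] [IsQuantale A] : Prop where
  exists_mul_eq_bot : ∀ a b : A, a ⊔ b = 1 → ∃ e f : A, a ⊔ e = 1 ∧ b ⊔ f = 1 ∧ e * f = ⊥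

section Basic

variable (A : Type*) [CommMonoid A] [CompleteLattice A]

/-- An element `p < 1` is `m`-prime if `a * b ≤ p` implies `a ≤ p` or `b ≤ p`. -/
def IsMPrime {A : Type*} [CommMonoid A] [CompleteLattice A] (p : A) : Prop :=
  p < 1 ∧ ∀ a b : A, a * b ≤ p → a ≤ p ∨ b ≤ p

/-- The set of `m`-prime elements. -/
def Spec : Type _ := {p : A // IsMPrime p}

/-- The set of maximal elements, i.e. elements maximal among those different from the top. -/
def Max (A : Type*) [CompleteLattice A] : Type _ := {m : A // IsCoatom m}

variable {A}

/-- `D a` is the set of `m`-primes `p` with `¬ a ≤ p`. -/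
def D (a : A) : Set (Spec A) := {p | ¬ a ≤ p.1}

end Basic

section Topology

variable (A : Type*) [CommMonoid A] [CompleteLattice A] [IsQuantale A] [IsCoherentQuantale A]

/-- The Zariski topology on `Spec A`: the open sets are the sets `D a`, equivalently
the closed sets are the sets `V a = {p | a ≤ p}`, for `a` in `A`. -/
@[reducible]
def zariskiTopology : TopologicalSpace (Spec A) where
  IsOpen U := ∃ a : A, U = D a
  isOpen_univ := by
    refine ⟨1, ?_⟩
    ext p
    simpa [D] using not_le_of_gt p.2.1
  isOpen_inter := by
    rintro _ _ ⟨a, rfl⟩ ⟨b, rfl⟩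
    refine ⟨a * b, ?_⟩
    ext p
    have h1 : a * b ≤ a := by
      calc a * b ≤ a * 1 := mul_le_mul_right (IsCoherentQuantale.one_eq_top (A := A) ▸ le_top) a
        _ = a := mul_one a
    have h2 : a * b ≤ b := by
      calc a * b ≤ 1 * b := mul_le_mul_left (IsCoherentQuantale.one_eq_top (A := A) ▸ le_top) b
        _ = b := one_mul b
    refine ⟨fun h hab => (p.2.2 a b hab).elim h.1 h.2, fun h => ⟨?_, ?_⟩⟩
    · exact fun ha => h (h1.trans ha)
    · exact fun hb => h (h2.trans hb)
  isOpen_sUnion := by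
    intro s hs
    refine ⟨sSup {a | D a ∈ s}, ?_⟩
    ext p
    constructor
    · rintro ⟨U, hU, hp⟩ hle
      obtain ⟨a, rfl⟩ := hs U hU
      have ha : a ≤ sSup {a | D a ∈ s} := le_sSup hU
      exact hp (ha.trans hle)
    · intro hp
      by_contra hcon
      exact hp (sSup_le fun a ha => by
        by_contra hap
        exact hcon ⟨D a, ha, hap⟩)

/-- The flat topology on `Spec A`: it has as a basis the complements of the compact open sets of
the Zariski topology. -/
@[reducible]
def flatTopology : TopologicalSpace (Spec A) :=
  TopologicalSpace.generateFrom
    {W | ∃ U : Set (Spec A), @IsOpen (Spec A) (zariskiTopology A) U ∧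
      @IsCompact (Spec A) (zariskiTopology A) U ∧ W = Uᶜ}

/-- The generating family of the flat topology is a basis. -/
theorem isTopologicalBasis_flatTopology :
    @TopologicalSpace.IsTopologicalBasis (Spec A) (flatTopology A)
      {W | ∃ U : Set (Spec A), @IsOpen (Spec A) (zariskiTopology A) U ∧
        @IsCompact (Spec A) (zariskiTopology A) U ∧ W = Uᶜ} := by
  let _ := flatTopology A
  refine ⟨?_, ?_, rfl⟩
  · rintro _ ⟨U, hU, hUc, rfl⟩ _ ⟨V, hV, hVc, rfl⟩ p hp
    refine ⟨(U ∪ V)ᶜ, ⟨U ∪ V, ?_, ?_, rfl⟩, ?_, ?_⟩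
    · exact @IsOpen.union _ _ _ (zariskiTopology A) hU hV
    · exact @IsCompact.union _ (zariskiTopology A) _ _ hUc hVc
    · rwa [Set.compl_union]
    · rw [Set.compl_union]
  · refine Set.eq_univ_of_forall fun p => ⟨Set.univ, ⟨∅, ?_, ?_, by simp⟩, trivial⟩
    · exact @isOpen_empty _ (zariskiTopology A)
    · exact @isCompact_empty _ (zariskiTopology A)

variable {A}

/-- Maximal elements are `m`-prime. -/
theorem isMPrime_of_isCoatom {m : A} (hm : IsCoatom m) : IsMPrime m := by
  have h1 : (1 : A) = ⊤ := IsCoherentQuantale.one_eq_top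
  refine ⟨h1 ▸ hm.lt_top, fun a b hab => ?_⟩
  by_contra! h
  have ha : m ⊔ a = ⊤ := hm.2 _ (left_lt_sup.2 h.1)
  refine h.2 ?_
  calc b = (m ⊔ a) * b := by rw [ha, ← h1, one_mul]
    _ = m * b ⊔ a * b := Quantale.sup_mul_distrib
    _ ≤ m := sup_le ?_ hab
  calc m * b ≤ m * 1 := mul_le_mul_right (h1 ▸ le_top) m
    _ = m := mul_one m

/-- The inclusion of `Max A` into `Spec A`. -/
def Max.toSpec (m : Max A) : Spec A := ⟨m.1, isMPrime_of_isCoatom m.2⟩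

variable (A) in
/-- The flat topology on `Max A`: the subspace topology induced by the flat topology
of `Spec A`. -/
@[reducible]
def maxFlatTopology : TopologicalSpace (Max A) :=
  TopologicalSpace.induced Max.toSpec (flatTopology A)

variable [IsNormalQuantale A]

/-- In a normal coherent quantale every `m`-prime lies below exactly one maximal element. -/
theorem existsUnique_max (p : Spec A) : ∃! m : Max A, p.1 ≤ m.1 := by
  have h1 : (1 : A) = ⊤ := IsCoherentQuantale.one_eq_top
  have hco : IsCoatomic A := CompleteLattice.coatomic_of_top_compact
    (h1 ▸ IsCoherentQuantale.isCompactElement_one)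
  have hp : p.1 ≠ ⊤ := h1 ▸ p.2.1.ne
  obtain ⟨m, hm, hpm⟩ := (hco.eq_top_or_exists_le_coatom p.1).resolve_left hp
  refine ⟨⟨m, hm⟩, hpm, fun n hn => ?_⟩
  by_contra hne
  have hne' : n.1 ≠ m := fun h => hne (Subtype.ext h)
  obtain ⟨e, f, he, hf, hef⟩ := IsNormalQuantale.exists_mul_eq_bot n.1 m
    (h1 ▸ n.2.sup_eq_top_of_ne hm hne')
  rcases p.2.2 e f (hef ▸ bot_le) with h | h
  · have h2 : e ≤ n.1 := h.trans hn
    exact n.2.1 (by rw [← h1, ← he, sup_eq_left.2 h2])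
  · exact hm.1 (by rw [← h1, ← hf, sup_eq_left.2 (h.trans hpm)])

/-- The map `γ : Spec A → Max A` sending an `m`-prime to the unique maximal element above it. -/
noncomputable def gamma (p : Spec A) : Max A := (existsUnique_max p).choose

/-- The defining property of `γ`. -/
theorem le_gamma (p : Spec A) : p.1 ≤ (gamma p).1 := (existsUnique_max p).choose_spec.1

/-- `γ` is a retraction of the inclusion of `Max A` into `Spec A`. -/
theorem gamma_toSpec (m : Max A) : gamma m.toSpec = m :=
  (existsUnique_max m.toSpec).unique (le_gamma m.toSpec) (le_refl m.1)

end Topology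

end CoherentQuantale

namespace CoherentQuantale

/-! Every ultrafilter on the spectrum has a limit for the patch topology, which is finer than the
flat one, so `Spec A` is flat-compact; if `γ` is continuous, its image `Max A` is compact too.
Conversely, let `Max A` be compact and `c` a compact element. The maximal elements not above `c`
form a closed, hence compact, set, covered by the open sets `{m | d ≤ m}` with `d` compact and `d ⊔
c = 1`. Products make this cover directed, so a single `d` suffices. Normality applied to `d ⊔ c =
1` then gives a compact `e` with `c ≤ γ p ↔ e ≤ p`, so preimages of subbasic open sets are open. -/

theorem isCompactElement_sup {A : Type*} [CompleteLattice A] {a b : A}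
    (ha : IsCompactElement a) (hb : IsCompactElement b) : IsCompactElement (a ⊔ b) := by
  classical
  have h := CompleteLattice.isCompactElement_finsetSup (f := id) ({a, b} : Finset A)
    (by simpa using ⟨ha, hb⟩)
  simpa using h

theorem isCompactElement_bot {A : Type*} [CompleteLattice A] : IsCompactElement (⊥ : A) := by
  simpa using CompleteLattice.isCompactElement_finsetSup (α := A) (f := id) ∅ (by simp)

section Patch

variable {A : Type*} [CommMonoid A] [CompleteLattice A] [IsQuantale A] [IsCoherentQuantale A]

theorem le_one_of_coherent (a : A) : a ≤ 1 :=
  IsCoherentQuantale.one_eq_top (A := A) ▸ le_top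

theorem mul_le_left_of_coherent (a b : A) : a * b ≤ a :=
  (mul_le_mul_right (le_one_of_coherent b) a).trans_eq (mul_one a)

theorem mul_le_right_of_coherent (a b : A) : a * b ≤ b :=
  mul_comm b a ▸ mul_le_left_of_coherent b a

/-- In the expansion of `(a ⊔ c) * (b ⊔ c)` every term except `a * b` lies below `c`. -/
theorem mul_sup_eq_one {a b c : A} (ha : a ⊔ c = 1) (hb : b ⊔ c = 1) : a * b ⊔ c = 1 := by
  refine le_antisymm (le_one_of_coherent _) ?_
  calc (1 : A) = (a ⊔ c) * (b ⊔ c) := by rw [ha, hb, one_mul]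
    _ = (a * b ⊔ c * b) ⊔ (a ⊔ c) * c := by
      rw [Quantale.mul_sup_distrib, Quantale.sup_mul_distrib]
    _ ≤ a * b ⊔ c := sup_le (sup_le_sup_left (mul_le_left_of_coherent c b) _)
      ((mul_le_right_of_coherent _ c).trans le_sup_right)

theorem exists_isCompactElement_le_not_le {a b : A} (h : ¬ a ≤ b) :
    ∃ c, IsCompactElement c ∧ c ≤ a ∧ ¬ c ≤ b := by
  rw [le_iff_compact_le_imp] at h
  push Not at h
  exact h

/-- If `a ⊔ b = 1`, then `a` can be replaced by a compact element below it. -/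
theorem exists_isCompactElement_sup_eq_one {a b : A} (h : a ⊔ b = 1) :
    ∃ c, IsCompactElement c ∧ c ≤ a ∧ c ⊔ b = 1 := by
  let s : Set A := (· ⊔ b) '' {c | IsCompactElement c ∧ c ≤ a}
  have hs : s.Nonempty := ⟨_, ⊥, ⟨isCompactElement_bot, bot_le⟩, rfl⟩
  have hdir : DirectedOn (· ≤ ·) s := by
    rintro _ ⟨c, hc, rfl⟩ _ ⟨d, hd, rfl⟩
    exact ⟨_, ⟨c ⊔ d, ⟨isCompactElement_sup hc.1 hd.1, sup_le hc.2 hd.2⟩, rfl⟩,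
      sup_le_sup_right le_sup_left b, sup_le_sup_right le_sup_right b⟩
  have hle : (1 : A) ≤ sSup s := by
    rw [← h]
    refine sup_le ?_ ?_
    · rw [← sSup_compact_le_eq a]
      exact sSup_le fun c hc => le_sup_left.trans (le_sSup ⟨c, hc, rfl⟩)
    · exact le_sup_right.trans (le_sSup ⟨⊥, ⟨isCompactElement_bot, bot_le⟩, rfl⟩)
  obtain ⟨_, ⟨c, hc, rfl⟩, hcb⟩ :=
    IsCoherentQuantale.isCompactElement_one (A := A) s _ hs hdir (isLUB_sSup s) hle
  exact ⟨c, hc.1, hc.2, le_antisymm (le_one_of_coherent _) hcb⟩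

/-- Every ultrafilter on the spectrum has a limit in the patch topology. -/
theorem exists_patch_limit (F : Ultrafilter (Spec A)) :
    ∃ q : Spec A, ∀ c : A, IsCompactElement c → (c ≤ q.1 ↔ (D c)ᶜ ∈ F) := by
  -- The limit is the join of the compact elements lying below `F`-almost every prime.
  let s : Set A := {c | IsCompactElement c ∧ (D c)ᶜ ∈ F}
  have hs : s.Nonempty := ⟨⊥, isCompactElement_bot,
    Filter.mem_of_superset Filter.univ_mem fun p _ hp => hp bot_le⟩
  have hdir : DirectedOn (· ≤ ·) s := by
    intro c hc d hd
    refine ⟨c ⊔ d, ⟨isCompactElement_sup hc.1 hd.1, ?_⟩, le_sup_left, le_sup_right⟩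
    filter_upwards [hc.2, hd.2] with p hp hp'
    simp only [D, Set.mem_compl_iff, Set.mem_ofPred_eq, not_not] at hp hp' ⊢
    exact sup_le hp hp'
  have key : ∀ c : A, IsCompactElement c → (c ≤ sSup s ↔ (D c)ᶜ ∈ F) := by
    refine fun c hc => ⟨fun h => ?_, fun h => le_sSup ⟨hc, h⟩⟩
    obtain ⟨d, hd, hcd⟩ := hc s _ hs hdir (isLUB_sSup s) h
    filter_upwards [hd.2] with p hp
    simp only [D, Set.mem_compl_iff, Set.mem_ofPred_eq, not_not] at hp ⊢
    exact hcd.trans hp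
  refine ⟨⟨sSup s, lt_of_le_not_ge (le_one_of_coherent _) fun h => ?_, fun a b hab => ?_⟩, key⟩
  · obtain ⟨p, hp⟩ := F.nonempty_of_mem ((key 1 IsCoherentQuantale.isCompactElement_one).1 h)
    exact hp (not_le_of_gt p.2.1)
  · by_contra! h
    -- `key` only concerns compact elements, so `a` and `b` are replaced by compact witnesses, whose
    -- product is compact by coherence.
    obtain ⟨c, hc, hca, hcs⟩ := exists_isCompactElement_le_not_le h.1
    obtain ⟨d, hd, hdb, hds⟩ := exists_isCompactElement_le_not_le h.2
    have hcd := (key _ (IsCoherentQuantale.isCompactElement_mul c d hc hd)).1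
      ((mul_le_mul' hca hdb).trans hab)
    rw [key c hc, Ultrafilter.compl_mem_iff_notMem, not_not] at hcs
    rw [key d hd, Ultrafilter.compl_mem_iff_notMem, not_not] at hds
    obtain ⟨p, ⟨hpc, hpd⟩, hp⟩ := F.nonempty_of_mem
      (Filter.inter_mem (Filter.inter_mem hcs hds) hcd)
    simp only [D, Set.mem_compl_iff, Set.mem_ofPred_eq, not_not] at hpc hpd hp
    exact (p.2.2 c d hp).elim hpc hpd

/-- A patch limit of an ultrafilter containing `D c` stays in `D c`, and it is also a Zariski limit
because each `D a` is the union of the `D d` with `d ≤ a` compact. -/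
theorem isCompact_D_of_isCompactElement {c : A} (hc : IsCompactElement c) :
    @IsCompact (Spec A) (zariskiTopology A) (D c) := by
  let _ := zariskiTopology A
  rw [isCompact_iff_ultrafilter_le_nhds]
  intro F hF
  rw [Filter.le_principal_iff] at hF
  obtain ⟨q, hq⟩ := exists_patch_limit F
  refine ⟨q, fun h => ?_, le_nhds_iff.2 ?_⟩
  · exact (Ultrafilter.compl_mem_iff_notMem.1 ((hq c hc).1 h)) hF
  · rintro _ hqa ⟨a, rfl⟩
    obtain ⟨d, hd, hda, hdq⟩ := exists_isCompactElement_le_not_le hqa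
    rw [hq d hd, Ultrafilter.compl_mem_iff_notMem, not_not] at hdq
    exact Filter.mem_of_superset hdq fun p hp hap => hp (hda.trans hap)

theorem exists_isCompactElement_D_eq {U : Set (Spec A)}
    (hU : @IsOpen (Spec A) (zariskiTopology A) U)
    (hUc : @IsCompact (Spec A) (zariskiTopology A) U) :
    ∃ c : A, IsCompactElement c ∧ U = D c := by
  let _ := zariskiTopology A
  obtain ⟨a, rfl⟩ := hU
  have : Nonempty {c : A // IsCompactElement c ∧ c ≤ a} := ⟨⊥, isCompactElement_bot, bot_le⟩
  obtain ⟨⟨c, hc, hca⟩, h⟩ := hUc.elim_directed_cover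
    (fun c : {c : A // IsCompactElement c ∧ c ≤ a} => D c.1) (fun c => ⟨c.1, rfl⟩)
    (fun p hp => by
      obtain ⟨c, hc, hca, hcp⟩ := exists_isCompactElement_le_not_le hp
      exact Set.mem_iUnion.2 ⟨⟨c, hc, hca⟩, hcp⟩)
    (fun c d => ⟨⟨c.1 ⊔ d.1, isCompactElement_sup c.2.1 d.2.1, sup_le c.2.2 d.2.2⟩,
      fun p hp h => hp (le_sup_left.trans h), fun p hp h => hp (le_sup_right.trans h)⟩)
  exact ⟨c, hc, h.antisymm fun p hp hap => hp (hca.trans hap)⟩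

variable (A) in
/-- The flat topology is generated by the sets `{p | c ≤ p}` with `c` compact. -/
theorem flatTopology_eq_generateFrom :
    flatTopology A =
      TopologicalSpace.generateFrom {W | ∃ c : A, IsCompactElement c ∧ W = (D c)ᶜ} := by
  unfold flatTopology
  congr 1
  ext W
  constructor
  · rintro ⟨U, hU, hUc, rfl⟩
    obtain ⟨c, hc, rfl⟩ := exists_isCompactElement_D_eq hU hUc
    exact ⟨c, hc, rfl⟩
  · rintro ⟨c, hc, rfl⟩
    exact ⟨D c, ⟨c, rfl⟩, isCompact_D_of_isCompactElement hc, rfl⟩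

theorem isOpen_flatTopology_compl_D {c : A} (hc : IsCompactElement c) :
    @IsOpen (Spec A) (flatTopology A) (D c)ᶜ := by
  rw [flatTopology_eq_generateFrom]
  exact TopologicalSpace.isOpen_generateFrom_of_mem ⟨c, hc, rfl⟩

variable (A) in
theorem compactSpace_flatTopology : @CompactSpace (Spec A) (flatTopology A) := by
  let _ := flatTopology A
  refine ⟨isCompact_iff_ultrafilter_le_nhds.2 fun F _ => ?_⟩
  obtain ⟨q, hq⟩ := exists_patch_limit F
  refine ⟨q, trivial, ?_⟩
  have h : Filter.Tendsto id (F : Filter (Spec A)) (@nhds _ (flatTopology A) q) := by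
    rw [flatTopology_eq_generateFrom, TopologicalSpace.tendsto_nhds_generateFrom_iff]
    rintro _ ⟨c, hc, rfl⟩ hqc
    exact (hq c hc).1 (not_not.1 hqc)
  exact h

theorem isOpen_maxFlatTopology_le {c : A} (hc : IsCompactElement c) :
    @IsOpen (Max A) (maxFlatTopology A) {m | c ≤ m.1} := by
  let _ := flatTopology A
  let _ := maxFlatTopology A
  convert (isOpen_flatTopology_compl_D hc).preimage (continuous_induced_dom (f := Max.toSpec))
    using 1
  ext m
  simp [D, Max.toSpec]

theorem sup_eq_one_of_not_le (m : Max A) {c : A} (h : ¬ c ≤ m.1) : m.1 ⊔ c = 1 := by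
  rw [IsCoherentQuantale.one_eq_top]
  exact m.2.2 _ (left_lt_sup.2 h)

theorem not_le_of_sup_eq_one (m : Max A) {a b : A} (h : a ⊔ b = 1) (ha : a ≤ m.1) :
    ¬ b ≤ m.1 := fun hb =>
  m.2.1 (top_le_iff.1 (IsCoherentQuantale.one_eq_top (A := A) ▸ h ▸ sup_le ha hb))

/-- If the space of maximal elements is compact in the flat topology, then the maximal elements
not above a compact `c` are those above some `d` with `d ⊔ c = 1`. -/
theorem exists_forall_le_iff_not_le
    (hcomp : @CompactSpace (Max A) (maxFlatTopology A)) {c : A} (hc : IsCompactElement c) :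
    ∃ d : A, d ⊔ c = 1 ∧ ∀ m : Max A, d ≤ m.1 ↔ ¬ c ≤ m.1 := by
  let _ := maxFlatTopology A
  have hclosed : IsClosed {m : Max A | ¬ c ≤ m.1} :=
    isOpen_compl_iff.1 (by simpa [Set.compl_ofPred] using isOpen_maxFlatTopology_le hc)
  have : Nonempty {d : A // IsCompactElement d ∧ d ⊔ c = 1} :=
    ⟨1, IsCoherentQuantale.isCompactElement_one, sup_eq_left.2 (le_one_of_coherent c)⟩
  obtain ⟨⟨d, hd, hdc⟩, h⟩ := hclosed.isCompact.elim_directed_cover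
    (fun d : {d : A // IsCompactElement d ∧ d ⊔ c = 1} => {m : Max A | d.1 ≤ m.1})
    (fun d => isOpen_maxFlatTopology_le d.2.1)
    -- Here `m ⊔ c = 1` by maximality, and `m` shrinks to a compact `d ≤ m` still comaximal with
    -- `c`.
    (fun m hm => by
      obtain ⟨d, hd, hdm, hdc⟩ := exists_isCompactElement_sup_eq_one (sup_eq_one_of_not_le m hm)
      exact Set.mem_iUnion.2 ⟨⟨d, hd, hdc⟩, hdm⟩)
    (fun d e => ⟨⟨d.1 * e.1, IsCoherentQuantale.isCompactElement_mul _ _ d.2.1 e.2.1,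
        mul_sup_eq_one d.2.2 e.2.2⟩,
      fun m hm => (mul_le_left_of_coherent d.1 e.1).trans hm,
      fun m hm => (mul_le_right_of_coherent d.1 e.1).trans hm⟩)
  exact ⟨d, hdc, fun m => ⟨not_le_of_sup_eq_one m hdc, fun hm => h hm⟩⟩

end Patch

section Retraction

variable {A : Type*} [CommMonoid A] [CompleteLattice A] [IsQuantale A] [IsCoherentQuantale A]
  [IsNormalQuantale A]

theorem gamma_surjective : Function.Surjective (gamma : Spec A → Max A) :=
  fun m => ⟨m.toSpec, gamma_toSpec m⟩

/-- If the space of maximal elements is compact in the flat topology, then the inverse image under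
`γ` of the maximal elements above a compact `c` is of the form `{p | e ≤ p}` with `e` compact. -/
theorem exists_forall_le_gamma_iff
    (hcomp : @CompactSpace (Max A) (maxFlatTopology A)) {c : A} (hc : IsCompactElement c) :
    ∃ e : A, IsCompactElement e ∧ ∀ p : Spec A, c ≤ (gamma p).1 ↔ e ≤ p.1 := by
  obtain ⟨d, hdc, hd⟩ := exists_forall_le_iff_not_le hcomp hc
  obtain ⟨e', f, he', hf, hef'⟩ := IsNormalQuantale.exists_mul_eq_bot d c hdc
  -- Shrinking `e'` to a compact `e` makes `{p | e ≤ p}` flat-open.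
  obtain ⟨e, hec, hee', he⟩ := exists_isCompactElement_sup_eq_one (sup_comm d e' ▸ he')
  have hef : e * f = ⊥ := le_bot_iff.1 (hef' ▸ mul_le_mul_left hee' f)
  refine ⟨e, hec, fun p => ⟨fun h => ?_, fun h => ?_⟩⟩
  -- Since `e * f = ⊥`, the prime `p` is above `e` or `f`; the latter would put `c ⊔ f = 1` below `γ
  -- p`.
  · exact (p.2.2 e f (hef ▸ bot_le)).resolve_right fun hfp =>
      not_le_of_sup_eq_one _ hf h (hfp.trans (le_gamma p))
  · exact not_not.1 fun hcp =>
      not_le_of_sup_eq_one _ he (h.trans (le_gamma p)) ((hd _).2 hcp)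

end Retraction

end CoherentQuantale

theorem theorem7p9 {A : Type*} [CommMonoid A] [CompleteLattice A] [IsQuantale A]
    [CoherentQuantale.IsCoherentQuantale A] [CoherentQuantale.IsNormalQuantale A] :
    @Continuous (CoherentQuantale.Spec A) (CoherentQuantale.Max A)
        (CoherentQuantale.flatTopology A) (CoherentQuantale.maxFlatTopology A)
        CoherentQuantale.gamma ↔
      @CompactSpace (CoherentQuantale.Max A) (CoherentQuantale.maxFlatTopology A) := by
  constructor
  · intro h
    let _ := CoherentQuantale.flatTopology A
    let _ := CoherentQuantale.maxFlatTopology A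
    have := CoherentQuantale.compactSpace_flatTopology A
    exact CoherentQuantale.gamma_surjective.compactSpace h
  · intro hcomp
    have h : @Continuous _ _ (CoherentQuantale.flatTopology A) (TopologicalSpace.generateFrom
        {W | ∃ c : A, IsCompactElement c ∧ W = (CoherentQuantale.D c)ᶜ})
        (CoherentQuantale.Max.toSpec ∘ CoherentQuantale.gamma (A := A)) := by
      rw [continuous_generateFrom_iff]
      rintro _ ⟨c, hc, rfl⟩
      obtain ⟨e, he, hce⟩ := CoherentQuantale.exists_forall_le_gamma_iff hcomp hc
      convert CoherentQuantale.isOpen_flatTopology_compl_D he using 1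
      ext p
      simpa [CoherentQuantale.D, CoherentQuantale.Max.toSpec] using hce p
    rw [← CoherentQuantale.flatTopology_eq_generateFrom] at h
    exact continuous_induced_rng.2 h
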